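/- Let $f:\mathbb{R}^n\to\mathbb{R}$ be twice continuously differentiable and let $g:\mathbb{R}^n\to\mathbb{R}\cup\{+\infty\}$ be a proper polyhedral function (its epigraph is the intersection of finitely many closed half-spaces of $\mathbb{R}^n\times\mathbb{R}$) with $\mathrm{dom}\,g=\{x: g(x)<\infty\}\subseteq\mathbb{R}^n_+$. Put $\phi(x)=f(x)+g(x)$ and $\Phi(y)=f(y^2)+g(y^2)$, where $y^2$ is the componentwise square. For an extended real-valued function $h$ on $\mathbb{R}^n$ and a point $x$ with $h(x)$ finite, $\hat\partial h(x)$ denotes the set of $v$ with $h(z)\ge h(x)+\langle v,z-x\rangle+o(\|z-x\|)$ as $z\to x$, and the subdifferential $\partial h(x)$ is the set of limits $v=\lim v^k$ with $v^k\in\hat\partial h(x^k)$, $x^k\to x$, $h(x^k)\to h(x)$; if $h(x)$ is not finite, $\partial h(x)=\emptyset$. A proper lower semicontinuous $h$ has the Kurdyka–Łojasiewicz (KL) property at $\bar x$ with exponent $\alpha\in[0,1)$ if $\partial h(\bar x)\neq\emptyset$ and there are $\bar c>0$, $a\in(0,\infty]$ and a neighborhood $V$ of $\bar x$ such that, with $\varphi(s)=\bar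 c\,s^{1-\alpha}$, $$\varphi'\big(h(x)-h(\bar x)\big)\,\mathrm{dist}\big(0,\partial h(x)\big)\ge 1\qquad\text{for all }x\in V\text{ with }0<h(x)-h(\bar x)<a,$$ where $\mathrm{dist}(0,\emptyset)=+\infty$. Let $\bar y\in\mathbb{R}^n$ and $\bar x=\bar y^2$. Suppose that strict complementarity $0\in\mathrm{ri}\,(\partial\phi(\bar x))$ holds, where $\mathrm{ri}$ denotes the relative interior, and that $\phi$ has the KL property at $\bar x$ with exponent $\alpha\in(0,1)$. Then $\Phi$ has the KL property at $\bar y$ with exponent $\max\{\alpha,1/2\}$. -/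

import Mathlib

open Filter Topology
open scoped ENNReal

/-- Componentwise square `y ↦ y²` on `ℝⁿ`. -/
noncomputable def sqMap {n : ℕ} (y : EuclideanSpace ℝ (Fin n)) : EuclideanSpace ℝ (Fin n) :=
  WithLp.toLp 2 (fun i => y i ^ 2)

/-- An extended real-valued function is proper if it never takes the value `-∞`
and is not identically `+∞`. -/
def ProperFun {X : Type*} (h : X → EReal) : Prop :=
  (∀ x, h x ≠ ⊥) ∧ ∃ x, h x ≠ ⊤

/-- A polyhedral set: the intersection of finitely many closed half-spaces
(the whole space if there are none). -/
def IsPolyhedralSet {V : Type*} [AddCommGroup V] [Module ℝ V] (S : Set V) : Prop :=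
  ∃ (m : ℕ) (a : Fin m → (V →ₗ[ℝ] ℝ)) (b : Fin m → ℝ), S = {x | ∀ i, a i x ≤ b i}

/-- A polyhedral function: its epigraph is a polyhedral set. -/
def IsPolyhedralFun {V : Type*} [AddCommGroup V] [Module ℝ V] (g : V → EReal) : Prop :=
  IsPolyhedralSet {p : V × ℝ | g p.1 ≤ (p.2 : EReal)}

/-- `v` is a regular (Fréchet) subgradient of `h` at `x`: `h x` is finite and
`h z ≥ h x + ⟨v, z - x⟩ + o(‖z - x‖)` as `z → x`. -/
def IsRegularSubgradient {n : ℕ} (h : EuclideanSpace ℝ (Fin n) → EReal)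
    (x v : EuclideanSpace ℝ (Fin n)) : Prop :=
  h x ≠ ⊥ ∧ h x ≠ ⊤ ∧ ∀ ε : ℝ, 0 < ε → ∀ᶠ z in 𝓝 x,
    h x + ((inner ℝ v (z - x) - ε * ‖z - x‖ : ℝ) : EReal) ≤ h z

/-- The (limiting) subdifferential `∂h(x)`: all limits of regular subgradients `vₖ` at points
`xₖ → x` with `h(xₖ) → h(x)`. It is empty where `h` is not finite. -/
def subdiff {n : ℕ} (h : EuclideanSpace ℝ (Fin n) → EReal)
    (x : EuclideanSpace ℝ (Fin n)) : Set (EuclideanSpace ℝ (Fin n)) :=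
  {v | h x ≠ ⊥ ∧ h x ≠ ⊤ ∧ ∃ xs vs : ℕ → EuclideanSpace ℝ (Fin n),
    (∀ k, IsRegularSubgradient h (xs k) (vs k)) ∧
    Tendsto xs atTop (𝓝 x) ∧ Tendsto (fun k => h (xs k)) atTop (𝓝 (h x)) ∧
    Tendsto vs atTop (𝓝 v)}

/-- `ψ` is a desingularizing function on `[0, a)`, where `a ∈ (0, ∞]`. -/
def IsDesingularizing (a : EReal) (ψ : ℝ → ℝ) : Prop :=
  ψ 0 = 0 ∧
  (∀ s : ℝ, 0 ≤ s → (s : EReal) < a → 0 ≤ ψ s) ∧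
  ContinuousOn ψ {s : ℝ | 0 ≤ s ∧ (s : EReal) < a} ∧
  ConcaveOn ℝ {s : ℝ | 0 ≤ s ∧ (s : EReal) < a} ψ ∧
  DifferentiableOn ℝ ψ {s : ℝ | 0 < s ∧ (s : EReal) < a} ∧
  ContinuousOn (deriv ψ) {s : ℝ | 0 < s ∧ (s : EReal) < a} ∧
  ∀ s : ℝ, 0 < s → (s : EReal) < a → 0 < deriv ψ s

/-- The proper closed function `h` has the Kurdyka–Łojasiewicz property at `x₀ ∈ dom ∂h` with
desingularizing function `ψ`. The distance is `+∞` to the empty set. -/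
def HasKLWith {n : ℕ} (h : EuclideanSpace ℝ (Fin n) → EReal)
    (x₀ : EuclideanSpace ℝ (Fin n)) (ψ : ℝ → ℝ) : Prop :=
  ProperFun h ∧ LowerSemicontinuous h ∧ (subdiff h x₀).Nonempty ∧
  ∃ a : EReal, 0 < a ∧ IsDesingularizing a ψ ∧ ∃ V ∈ 𝓝 x₀, ∀ x ∈ V,
    0 < h x - h x₀ → h x - h x₀ < a →
      1 ≤ ENNReal.ofReal (deriv ψ (h x - h x₀).toReal) * Metric.infEDist 0 (subdiff h x)

/-- `h` has the Kurdyka–Łojasiewicz property at `x₀` with exponent `α ∈ [0, 1)`. -/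
def HasKLExponent {n : ℕ} (h : EuclideanSpace ℝ (Fin n) → EReal)
    (x₀ : EuclideanSpace ℝ (Fin n)) (α : ℝ) : Prop :=
  0 ≤ α ∧ α < 1 ∧ ∃ c : ℝ, 0 < c ∧ HasKLWith h x₀ (fun s => c * s ^ (1 - α))

/-!
Strict complementarity puts `-∇f(x₀)` in the relative interior of the convex subdifferential
`∂g(x₀)`. Let `L` be the linear span of `∂φ(x₀)`. Near `x₀` the polyhedral `g` is affine along
`x₀ + Lᗮ`, while along `L` the function `φ` grows at least linearly; since `dom g` lies in the
orthant, `L` contains every coordinate direction in which `y₀` vanishes.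

Write `x = y²`, let `u` and `w` be the components of `x - x₀` in `L` and `Lᗮ`, and let `v` be a
subgradient of `Φ` at `y`. Testing `v` on the curve whose square is the segment from `x` to
`x₀ + w` gives `√‖u‖ ≲ ‖v‖`: its velocity is only of order `√‖u‖` because `u` has the coordinates
`yᵢ²` where `y₀` vanishes, whereas `φ` decreases at rate `≳ ‖u‖`. Testing on curves whose squares
are translations along `Lᗮ` bounds the `Lᗮ`-component of `∇f(x) - ∇f(x₀)` by a multiple of `‖v‖`.
At `x₀ + w` that component of `∇f(x₀ + w) - ∇f(x₀)` is a subgradient of `φ`, so the KL inequality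
of `φ` bounds the excess `s'` of `φ` there by `s' ^ α ≲ ‖v‖`. Finally the excess at `x` satisfies
`s ≤ s' + C ‖u‖`: either `s'` or `‖u‖` dominates, which produces the exponents `α` and `1/2`.
-/

theorem eq_coe_sub_of_coe_add_eq_coe {a r : ℝ} {e : EReal} (h : (a : EReal) + e = r) :
    e = ((r - a : ℝ) : EReal) := by
  induction e with
  | bot => simp at h
  | top => simp at h
  | coe e => norm_cast at h ⊢; linarith

section Polyhedral

variable {V : Type*} [AddCommGroup V] [Module ℝ V]

theorem dual_prod_apply (a : Module.Dual ℝ (V × ℝ)) (w : V) (τ : ℝ) :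
    a (w, τ) = a (w, 0) + τ * a (0, 1) := by
  rw [← smul_eq_mul, ← map_smul, ← map_add]
  simp

theorem IsPolyhedralSet.convex {S : Set V} (hS : IsPolyhedralSet S) : Convex ℝ S := by
  obtain ⟨m, a, b, rfl⟩ := hS
  simp only [Set.ofPred_forall]
  exact convex_iInter fun i => convex_halfSpace_le (a i).isLinear (b i)

theorem IsPolyhedralSet.exists_local_cone [TopologicalSpace V] [IsTopologicalAddGroup V]
    [ContinuousSMul ℝ V] [T2Space V] [FiniteDimensional ℝ V] {S : Set V}
    (hS : IsPolyhedralSet S) {p₀ : V} (hp₀ : p₀ ∈ S) :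
    ∃ A : Set (Module.Dual ℝ V), A.Finite ∧ (∀ a ∈ A, ∀ p ∈ S, a (p - p₀) ≤ 0) ∧
      ∀ᶠ p in 𝓝 p₀, (∀ a ∈ A, a (p - p₀) ≤ 0) → p ∈ S := by
  obtain ⟨m, a, b, rfl⟩ := hS
  refine ⟨a '' {i | a i p₀ = b i}, (Set.toFinite _).image a, ?_, ?_⟩
  · rintro _ ⟨i, hi, rfl⟩ p hp
    rw [map_sub, Set.mem_ofPred.1 hi, sub_nonpos]
    exact hp i
  · have inactive : ∀ᶠ p in 𝓝 p₀, ∀ i, a i p₀ ≠ b i → a i p < b i := by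
      refine eventually_all.2 fun i => eventually_imp_distrib_left.2 fun hi => ?_
      exact (a i).continuous_of_finiteDimensional.continuousAt.eventually_lt_const
        (lt_of_le_of_ne (hp₀ i) hi)
    filter_upwards [inactive] with p hp hcone i
    by_cases hi : a i p₀ = b i
    · have := hcone _ ⟨i, hi, rfl⟩
      rwa [map_sub, hi, sub_nonpos] at this
    · exact (hp i hi).le

theorem IsPolyhedralFun.add_smul_sub_le {g : V → EReal} (hg : IsPolyhedralFun g) {x z : V}
    {σ τ : ℝ} (hx : g x ≤ σ) (hz : g z ≤ τ) {t : ℝ} (ht : t ∈ Set.Icc (0 : ℝ) 1) :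
    g (x + t • (z - x)) ≤ ((σ + t * (τ - σ) : ℝ) : EReal) :=
  hg.convex.add_smul_sub_mem (x := (x, σ)) (y := (z, τ)) hx hz ht

end Polyhedral

section ConvexSubdiff

variable {E : Type*} [NormedAddCommGroup E] [InnerProductSpace ℝ E] {g : E → EReal}
  {x₀ q s d : E} {γ ε : ℝ} {L : Submodule ℝ E}

/-- The subdifferential of `g` at `x` in the sense of convex analysis, used at points where `g` is
finite; unlike `subdiff`, it is defined by a global inequality. -/
def convexSubdiff (g : E → EReal) (x : E) : Set E :=
  {s | ∀ z, g x + ((inner ℝ s (z - x) : ℝ) : EReal) ≤ g z}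

theorem mem_convexSubdiff_iff (hγ : g x₀ = γ) :
    s ∈ convexSubdiff g x₀ ↔ ∀ z (τ : ℝ), g z ≤ τ → γ + inner ℝ s (z - x₀) ≤ τ := by
  rw [convexSubdiff, Set.mem_ofPred, hγ]
  constructor
  · intro h z τ hz
    exact_mod_cast (h z).trans hz
  · intro h z
    refine EReal.le_of_forall_lt_iff_le.1 fun τ hτ => ?_
    exact_mod_cast h z τ hτ.le

/-- `g x₀ = γ` and `q` is a relative interior point of the convex subdifferential of `g` at `x₀`,
whose affine hull is `q + L`; the radius `ε` quantifies interiority. -/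
structure IsRelIntSubgradient (g : E → EReal) (x₀ : E) (γ : ℝ) (q : E) (L : Submodule ℝ E)
    (ε : ℝ) : Prop where
  value : g x₀ = γ
  pos : 0 < ε
  add_mem : ∀ s ∈ L, ‖s‖ ≤ ε → q + s ∈ convexSubdiff g x₀
  mem_of_add_mem : ∀ s, q + s ∈ convexSubdiff g x₀ → s ∈ L

theorem real_inner_starProjection_self (L : Submodule ℝ E) [L.HasOrthogonalProjection] (w : E) :
    inner ℝ (L.starProjection w) w = ‖L.starProjection w‖ ^ 2 :=
  L.re_inner_starProjection_eq_normSq w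

theorem tendsto_starProjection_sub (x₀ : E) (L : Submodule ℝ E) [L.HasOrthogonalProjection] :
    Tendsto (fun x => L.starProjection (x - x₀)) (𝓝 x₀) (𝓝 0) :=
  Continuous.tendsto' (by fun_prop) _ _ (by simp)

theorem norm_starProjection_sub_le (L : Submodule ℝ E) [L.HasOrthogonalProjection] (x y z : E) :
    ‖L.starProjection (x - z)‖ ≤ ‖L.starProjection (y - z)‖ + ‖y - x‖ := by
  calc ‖L.starProjection (x - z)‖
      = ‖L.starProjection (y - z) - L.starProjection (y - x)‖ := by
        rw [← map_sub, sub_sub_sub_cancel_left]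
    _ ≤ ‖L.starProjection (y - z)‖ + ‖L.starProjection (y - x)‖ := norm_sub_le _ _
    _ ≤ ‖L.starProjection (y - z)‖ + ‖y - x‖ := by
        gcongr
        exact L.norm_starProjection_apply_le _

theorem exists_norm_sub_le_norm_starProjection {F : Type*} [SeminormedAddCommGroup F] {G : E → F}
    (hG : LocallyLipschitz G) (x₀ : E) (L : Submodule ℝ E) [L.HasOrthogonalProjection] :
    ∃ M ≥ (0 : ℝ), ∀ᶠ x in 𝓝 x₀, ‖G x - G (x₀ + Lᗮ.starProjection (x - x₀))‖ ≤
      M * ‖L.starProjection (x - x₀)‖ := by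
  obtain ⟨M, t, ht, hM⟩ := hG x₀
  have hlim : Tendsto (fun x => x₀ + Lᗮ.starProjection (x - x₀)) (𝓝 x₀) (𝓝 x₀) :=
    Continuous.tendsto' (by fun_prop) _ _ (by simp)
  refine ⟨M, M.2, ?_⟩
  filter_upwards [ht, hlim ht] with x hx hx'
  have hu : x - (x₀ + Lᗮ.starProjection (x - x₀)) = L.starProjection (x - x₀) := by
    rw [← sub_sub, sub_eq_iff_eq_add, L.starProjection_add_starProjection_orthogonal]
  rw [← hu, ← dist_eq_norm, ← dist_eq_norm]
  exact hM.dist_le_mul x hx _ hx'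

namespace IsRelIntSubgradient

theorem mem_convexSubdiff (h : IsRelIntSubgradient g x₀ γ q L ε) : q ∈ convexSubdiff g x₀ := by
  simpa using h.add_mem 0 L.zero_mem (by simpa using h.pos.le)

theorem add_inner_le (h : IsRelIntSubgradient g x₀ γ q L ε) (z : E) {τ : ℝ} (hz : g z ≤ τ) :
    γ + inner ℝ q (z - x₀) ≤ τ :=
  (mem_convexSubdiff_iff h.value).1 h.mem_convexSubdiff z τ hz

theorem ne_bot (h : IsRelIntSubgradient g x₀ γ q L ε) (z : E) : g z ≠ ⊥ := by
  have := h.mem_convexSubdiff z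
  rw [h.value, ← EReal.coe_add] at this
  exact ((EReal.bot_lt_coe _).trans_le this).ne'

theorem coe_toReal (h : IsRelIntSubgradient g x₀ γ q L ε) {z : E} (hz : g z ≠ ⊤) :
    ((g z).toReal : EReal) = g z :=
  EReal.coe_toReal hz (h.ne_bot z)

theorem add_inner_add_norm_le [L.HasOrthogonalProjection] (h : IsRelIntSubgradient g x₀ γ q L ε)
    {z : E} {τ : ℝ} (hz : g z ≤ τ) :
    γ + inner ℝ q (z - x₀) + ε * ‖L.starProjection (z - x₀)‖ ≤ τ := by
  set u := L.starProjection (z - x₀) with hu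
  rcases eq_or_ne u 0 with hu0 | hu0
  · simpa [hu0] using h.add_inner_le z hz
  have hu' : 0 < ‖u‖ := norm_pos_iff.2 hu0
  have hinner : inner ℝ ((ε / ‖u‖) • u) (z - x₀) = ε * ‖u‖ := by
    rw [real_inner_smul_left, hu, real_inner_starProjection_self, ← hu]
    field_simp
  have hmem : q + (ε / ‖u‖) • u ∈ convexSubdiff g x₀ :=
    h.add_mem _ (L.smul_mem _ (L.starProjection_apply_mem _)) (by
      rw [norm_smul, Real.norm_of_nonneg (div_nonneg h.pos.le hu'.le),
        div_mul_cancel₀ _ hu'.ne'])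
  have := (mem_convexSubdiff_iff h.value).1 hmem z τ hz
  rwa [inner_add_left, hinner, ← add_assoc] at this

theorem add_mem_convexSubdiff (h : IsRelIntSubgradient g x₀ γ q L ε) (hd : d ∈ Lᗮ)
    (hgd : g (x₀ + d) = ((γ + inner ℝ q d : ℝ) : EReal)) (hs : s ∈ L) (hsε : ‖s‖ ≤ ε) :
    q + s ∈ convexSubdiff g (x₀ + d) := by
  rw [mem_convexSubdiff_iff hgd]
  intro z τ hz
  have hz' := (mem_convexSubdiff_iff h.value).1 (h.add_mem s hs hsε) z τ hz
  have hsd : inner ℝ s d = 0 := L.inner_right_of_mem_orthogonal hs hd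
  rw [← sub_sub, inner_sub_right, inner_add_left _ _ d, hsd]
  linarith

section Functional

variable {a : Module.Dual ℝ (E × ℝ)}

theorem apply_zero_one_nonpos (h : IsRelIntSubgradient g x₀ γ q L ε)
    (ha : ∀ p ∈ {p : E × ℝ | g p.1 ≤ (p.2 : EReal)}, a (p - (x₀, γ)) ≤ 0) : a (0, 1) ≤ 0 := by
  have := ha (x₀, γ + 1) (h.value.trans_le (by exact_mod_cast (lt_add_one γ).le))
  simpa using this

/-- The functional bounds the epigraph from one side, so its gradient `p` in the space variable,
mixed with `q`, is again a subgradient up to scaling; hence `p + a(0, 1) q` lies in `L`. -/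
theorem apply_inner_eq_zero [FiniteDimensional ℝ E] (h : IsRelIntSubgradient g x₀ γ q L ε)
    (ha : ∀ p ∈ {p : E × ℝ | g p.1 ≤ (p.2 : EReal)}, a (p - (x₀, γ)) ≤ 0) (hd : d ∈ Lᗮ) :
    a (d, inner ℝ q d) = 0 := by
  obtain ⟨p, hp⟩ : ∃ p : E, ∀ w, inner ℝ p w = a (w, 0) :=
    ⟨(InnerProductSpace.toDual ℝ E).symm
      (LinearMap.toContinuousLinearMap (a ∘ₗ LinearMap.inl ℝ E ℝ)), by simp⟩
  set β := -a (0, 1)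
  have hβ0 : 0 ≤ β := neg_nonneg.2 (h.apply_zero_one_nonpos ha)
  have hsub : q + (1 + β)⁻¹ • (p - β • q) ∈ convexSubdiff g x₀ := by
    refine (mem_convexSubdiff_iff h.value).2 fun z τ hz => ?_
    have h1 : inner ℝ p (z - x₀) - (τ - γ) * β ≤ 0 := by
      have := ha (z, τ) hz
      rw [Prod.mk_sub_mk, dual_prod_apply, ← hp] at this
      linarith
    have h2 := h.add_inner_le z hz
    have h3 : (1 + β)⁻¹ * (inner ℝ p (z - x₀) + inner ℝ q (z - x₀)) ≤ τ - γ := by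
      rw [inv_mul_le_iff₀ (by positivity)]
      linarith
    have h4 : q + (1 + β)⁻¹ • (p - β • q) = (1 + β)⁻¹ • (p + q) := by
      match_scalars <;> field_simp
      ring
    rw [h4, real_inner_smul_left, inner_add_left]
    linarith
  have hmem : p - β • q ∈ L :=
    (L.smul_mem_iff (inv_ne_zero (by positivity))).1 (h.mem_of_add_mem _ hsub)
  have horth := L.inner_right_of_mem_orthogonal hmem hd
  rw [inner_sub_left, real_inner_smul_left, hp] at horth
  rw [dual_prod_apply]
  linarith

theorem eventually_apply_nonpos [FiniteDimensional ℝ E] (h : IsRelIntSubgradient g x₀ γ q L ε)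
    (ha : ∀ p ∈ {p : E × ℝ | g p.1 ≤ (p.2 : EReal)}, a (p - (x₀, γ)) ≤ 0) :
    ∀ᶠ C : ℝ in atTop, ∀ x, g x ≠ ⊤ →
      a (x - x₀, inner ℝ q (x - x₀) + C * ‖L.starProjection (x - x₀)‖) ≤ 0 := by
  rcases (h.apply_zero_one_nonpos ha).lt_or_eq with hneg | hzero
  · let M : E →L[ℝ] ℝ := LinearMap.toContinuousLinearMap
      (a ∘ₗ LinearMap.prod LinearMap.id (innerₛₗ ℝ q))
    have hM : ∀ w, M w = a (w, inner ℝ q w) := fun w => rfl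
    filter_upwards [eventually_ge_atTop (‖M‖ / -a (0, 1))] with C hC x _
    set w := x - x₀
    have hMw : M w = M (L.starProjection w) := by
      rw [← sub_eq_zero, ← map_sub, hM]
      exact h.apply_inner_eq_zero ha (L.sub_starProjection_mem_orthogonal w)
    calc a (w, inner ℝ q w + C * ‖L.starProjection w‖)
        = M (L.starProjection w) + C * ‖L.starProjection w‖ * a (0, 1) := by
          rw [dual_prod_apply, ← hMw, hM, dual_prod_apply a w (inner ℝ q w)]
          ring
      _ ≤ ‖M‖ * ‖L.starProjection w‖ + C * ‖L.starProjection w‖ * a (0, 1) := by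
          gcongr
          exact (le_abs_self _).trans (M.le_opNorm _)
      _ ≤ 0 := by
          rw [div_le_iff₀ (neg_pos.2 hneg)] at hC
          nlinarith [norm_nonneg (L.starProjection w)]
  · refine Eventually.of_forall fun C x hx => ?_
    have := ha (x, (g x).toReal) (h.coe_toReal hx).ge
    rw [Prod.mk_sub_mk, dual_prod_apply, hzero, mul_zero] at this
    rwa [dual_prod_apply, hzero, mul_zero]

end Functional

variable [FiniteDimensional ℝ E]

theorem eventually_le_linear (h : IsRelIntSubgradient g x₀ γ q L ε) (hg : IsPolyhedralFun g) :
    ∃ C ≥ (0 : ℝ), ∀ᶠ x in 𝓝 x₀, g x ≠ ⊤ →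
      g x ≤ ((γ + inner ℝ q (x - x₀) + C * ‖L.starProjection (x - x₀)‖ : ℝ) : EReal) := by
  obtain ⟨A, hA, hepi, hcone⟩ := hg.exists_local_cone (p₀ := (x₀, γ)) h.value.le
  obtain ⟨C, hC, hC0⟩ := (((eventually_all_finite hA).2
    fun a ha => h.eventually_apply_nonpos (hepi a ha)).and (eventually_ge_atTop 0)).exists
  refine ⟨C, hC0, ?_⟩
  have hlim : Tendsto
      (fun x => (x, γ + inner ℝ q (x - x₀) + C * ‖L.starProjection (x - x₀)‖))
      (𝓝 x₀) (𝓝 (x₀, γ)) :=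
    Continuous.tendsto' (by fun_prop) _ _ (by simp)
  filter_upwards [hlim.eventually hcone] with x hx hgx
  refine hx fun a ha => ?_
  rw [Prod.mk_sub_mk, add_assoc, add_sub_cancel_left]
  exact hC a ha x hgx

theorem tendsto_toReal (h : IsRelIntSubgradient g x₀ γ q L ε) (hg : IsPolyhedralFun g) :
    Tendsto (fun x => (g x).toReal) (𝓝[{x | g x ≠ ⊤}] x₀) (𝓝 γ) := by
  obtain ⟨C, -, hC⟩ := h.eventually_le_linear hg
  have lower : Tendsto (fun x => γ + inner ℝ q (x - x₀)) (𝓝 x₀) (𝓝 γ) :=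
    Continuous.tendsto' (by fun_prop) _ _ (by simp)
  have upper : Tendsto
      (fun x => γ + inner ℝ q (x - x₀) + C * ‖L.starProjection (x - x₀)‖) (𝓝 x₀) (𝓝 γ) :=
    Continuous.tendsto' (by fun_prop) _ _ (by simp)
  refine tendsto_of_tendsto_of_tendsto_of_le_of_le' (lower.mono_left nhdsWithin_le_nhds)
    (upper.mono_left nhdsWithin_le_nhds) ?_ ?_
  · filter_upwards [self_mem_nhdsWithin] with x hx
    exact h.add_inner_le x (h.coe_toReal hx).ge
  · filter_upwards [nhdsWithin_le_nhds hC, self_mem_nhdsWithin] with x hxC hx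
    rw [← EReal.coe_le_coe_iff, h.coe_toReal hx]
    exact hxC hx

theorem eventually_add_le (h : IsRelIntSubgradient g x₀ γ q L ε) (hg : IsPolyhedralFun g) :
    ∀ᶠ x in 𝓝 x₀, ∀ᶠ d in 𝓝 (0 : E), d ∈ Lᗮ →
      g (x + d) ≤ g x + ((inner ℝ q d : ℝ) : EReal) := by
  obtain ⟨A, -, hepi, hcone⟩ := hg.exists_local_cone (p₀ := (x₀, γ)) h.value.le
  have hgraph : Tendsto (fun x => (x, (g x).toReal)) (𝓝[{x | g x ≠ ⊤}] x₀) (𝓝 (x₀, γ)) :=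
    (tendsto_id.mono_left nhdsWithin_le_nhds).prodMk_nhds (h.tendsto_toReal hg)
  have hnear := eventually_nhdsWithin_iff.1 (hgraph.eventually (eventually_eventually_nhds.2 hcone))
  filter_upwards [hnear] with x hx
  rcases eq_or_ne (g x) ⊤ with htop | hfin
  · exact Eventually.of_forall fun d _ => by simp [htop]
  have htranslate : Tendsto (fun d => (x + d, (g x).toReal + inner ℝ q d)) (𝓝 0)
      (𝓝 (x, (g x).toReal)) :=
    Continuous.tendsto' (by fun_prop) _ _ (by simp)
  filter_upwards [htranslate.eventually (hx hfin)] with d hd hdL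
  rw [← h.coe_toReal hfin, ← EReal.coe_add]
  refine hd fun a ha => ?_
  have hsplit : ((x + d, (g x).toReal + inner ℝ q d) : E × ℝ) - (x₀, γ)
      = ((x, (g x).toReal) - (x₀, γ)) + (d, inner ℝ q d) := by
    ext1 <;> simp only [Prod.fst_sub, Prod.snd_sub, Prod.fst_add, Prod.snd_add] <;> abel
  rw [hsplit, map_add, h.apply_inner_eq_zero (hepi a ha) hdL, add_zero]
  exact hepi a ha (x, (g x).toReal) (h.coe_toReal hfin).ge

theorem eventually_eq_add_inner (h : IsRelIntSubgradient g x₀ γ q L ε) (hg : IsPolyhedralFun g) :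
    ∀ᶠ d in 𝓝 (0 : E), d ∈ Lᗮ → g (x₀ + d) = ((γ + inner ℝ q d : ℝ) : EReal) := by
  filter_upwards [(h.eventually_add_le hg).self_of_nhds] with d hle hd
  refine le_antisymm ?_ ?_
  · simpa only [h.value, ← EReal.coe_add] using hle hd
  · simpa only [h.value, ← EReal.coe_add, add_sub_cancel_left] using
      h.mem_convexSubdiff (x₀ + d)

theorem eventually_segment_le (h : IsRelIntSubgradient g x₀ γ q L ε) (hg : IsPolyhedralFun g) :
    ∀ᶠ x in 𝓝 x₀, ∀ t ∈ Set.Icc (0 : ℝ) 1, g (x + t • -L.starProjection (x - x₀)) ≤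
      g x + ((t * (inner ℝ q (-L.starProjection (x - x₀)) - ε * ‖L.starProjection (x - x₀)‖) : ℝ)
        : EReal) := by
  filter_upwards [(tendsto_starProjection_sub x₀ Lᗮ).eventually (h.eventually_eq_add_inner hg)]
    with x hx t ht
  rcases eq_or_ne (g x) ⊤ with htop | hfin
  · rw [htop, EReal.top_add_coe]
    exact le_top
  have hend := hx (Lᗮ.starProjection_apply_mem _)
  have hsharp := h.add_inner_add_norm_le (h.coe_toReal hfin).ge
  have hsplit := L.starProjection_add_starProjection_orthogonal (x - x₀)
  set u := L.starProjection (x - x₀)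
  set w := Lᗮ.starProjection (x - x₀)
  have hdir : -u = x₀ + w - x := by
    rw [eq_sub_of_add_eq' hsplit]; abel
  have hseg := hg.add_smul_sub_le (h.coe_toReal hfin).ge hend.le ht
  rw [← hdir] at hseg
  have hslope : γ + inner ℝ q w - (g x).toReal ≤ inner ℝ q (-u) - ε * ‖u‖ := by
    rw [← hsplit, inner_add_right] at hsharp
    rw [inner_neg_right]
    linarith
  calc g (x + t • -u) ≤ (((g x).toReal + t * (inner ℝ q (-u) - ε * ‖u‖) : ℝ) : EReal) :=
        hseg.trans (EReal.coe_le_coe_iff.2 (by gcongr; exact ht.1))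
    _ = g x + ((t * (inner ℝ q (-u) - ε * ‖u‖) : ℝ) : EReal) := by
        rw [EReal.coe_add, h.coe_toReal hfin]

theorem exists_excess_le {f : E → ℝ} (hf : LocallyLipschitz f) {φ : E → EReal}
    (hφ : ∀ x, φ x = (f x : EReal) + g x) (h : IsRelIntSubgradient g x₀ γ q L ε)
    (hg : IsPolyhedralFun g) :
    ∃ C ≥ (0 : ℝ), ∀ᶠ x in 𝓝 x₀, ∀ s : ℝ, φ x = ((f x₀ + γ + s : ℝ) : EReal) →
      s ≤ f (x₀ + Lᗮ.starProjection (x - x₀)) - f x₀ + inner ℝ q (Lᗮ.starProjection (x - x₀))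
        + C * ‖L.starProjection (x - x₀)‖ := by
  obtain ⟨C, hC0, hC⟩ := h.eventually_le_linear hg
  obtain ⟨M, hM0, hM⟩ := exists_norm_sub_le_norm_starProjection hf x₀ L
  refine ⟨C + M + ‖q‖, by positivity, ?_⟩
  filter_upwards [hC, hM] with x hCx hMx s hs
  have hgx : g x = ((f x₀ + γ + s - f x : ℝ) : EReal) :=
    eq_coe_sub_of_coe_add_eq_coe ((hφ x).symm.trans hs)
  have hgle := hCx (hgx ▸ EReal.coe_ne_top _)
  have hsplit := L.starProjection_add_starProjection_orthogonal (x - x₀)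
  set u := L.starProjection (x - x₀)
  set w := Lᗮ.starProjection (x - x₀)
  rw [hgx, EReal.coe_le_coe_iff, ← hsplit, inner_add_right] at hgle
  have hfle : f x - f (x₀ + w) ≤ M * ‖u‖ := (Real.le_norm_self _).trans hMx
  have hqle : inner ℝ q u ≤ ‖q‖ * ‖u‖ := real_inner_le_norm q u
  linarith

end IsRelIntSubgradient

end ConvexSubdiff

section InnerProductSpace

variable {E : Type*} [NormedAddCommGroup E] [InnerProductSpace ℝ E]

theorem mul_le_mul_norm_of_inner_le_neg {v w : E} {c A σ : ℝ} (hA : 0 ≤ A) (hσ : 0 ≤ σ)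
    (hw : ‖w‖ ≤ A * σ) (h : inner ℝ v w ≤ -(c * σ ^ 2)) : c * σ ≤ A * ‖v‖ := by
  rcases hσ.eq_or_lt with rfl | hσ
  · simpa using mul_nonneg hA (norm_nonneg v)
  refine le_of_mul_le_mul_right ?_ hσ
  calc c * σ * σ = c * σ ^ 2 := by ring
    _ ≤ -inner ℝ v w := le_neg_of_le_neg h
    _ ≤ ‖v‖ * ‖w‖ := (neg_le_abs _).trans (abs_real_inner_le_norm v w)
    _ ≤ ‖v‖ * (A * σ) := by gcongr
    _ = A * ‖v‖ * σ := by ring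

theorem exists_closedBall_subset_of_zero_mem_intrinsicInterior {V : Type*}
    [NormedAddCommGroup V] [NormedSpace ℝ V] {S : Set V} (h : 0 ∈ intrinsicInterior ℝ S) :
    ∃ ε > 0, ∀ s ∈ Submodule.span ℝ S, ‖s‖ ≤ ε → s ∈ S := by
  obtain ⟨y, hy, hy0⟩ := mem_intrinsicInterior.1 h
  obtain ⟨ε, hε, hball⟩ := Metric.nhds_basis_closedBall.mem_iff.1 (mem_interior_iff_mem_nhds.1 hy)
  have hspan : (affineSpan ℝ S : Set V) = Submodule.span ℝ S := by
    rw [← affineSpan_insert_zero, Set.insert_eq_of_mem (intrinsicInterior_subset h)]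
  refine ⟨ε, hε, fun s hs hsε => ?_⟩
  have hs' : s ∈ affineSpan ℝ S := hspan.ge hs
  refine hball (show (⟨s, hs'⟩ : affineSpan ℝ S) ∈ _ from ?_)
  rwa [Metric.mem_closedBall, Subtype.dist_eq, hy0, dist_zero_right]

theorem hasDerivAt_comp_add_smul [CompleteSpace E] {f : E → ℝ} {x : E}
    (hf : DifferentiableAt ℝ f x) (d : E) :
    HasDerivAt (fun t : ℝ => f (x + t • d)) (inner ℝ (gradient f x) d) 0 := by
  have hray : HasDerivAt (fun t : ℝ => x + t • d) d 0 := by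
    simpa using ((hasDerivAt_id (0 : ℝ)).smul_const d).const_add x
  have hf' : HasFDerivAt f (fderiv ℝ f x) (x + (0 : ℝ) • d) := by
    simpa using hf.hasFDerivAt
  rw [inner_gradient_left]
  exact hf'.comp_hasDerivAt (0 : ℝ) hray

theorem locallyLipschitz_of_continuous_gradient [CompleteSpace E] {f : E → ℝ}
    (hf : Differentiable ℝ f) (hf' : Continuous (gradient f)) : LocallyLipschitz f := by
  intro x
  have hcont : Continuous (fderiv ℝ f) := by
    simpa [Function.comp_def, toDual_gradient] using
      (InnerProductSpace.toDual ℝ E).continuous.comp hf'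
  exact (hasStrictFDerivAt_of_hasFDerivAt_of_continuousAt
    (.of_forall fun z => (hf z).hasFDerivAt) hcont.continuousAt).exists_lipschitzOnWith

theorem locallyLipschitz_gradient [CompleteSpace E] {f : E → ℝ} (hf : ContDiff ℝ 2 f) :
    LocallyLipschitz (gradient f) := by
  have hfderiv : ContDiff ℝ 1 (fderiv ℝ f) := hf.fderiv_right (by norm_num)
  exact ((InnerProductSpace.toDual ℝ E).symm.contDiff.comp hfderiv).locallyLipschitz

end InnerProductSpace

section RegularSubgradient

variable {n : ℕ} {h φ g : EuclideanSpace ℝ (Fin n) → EReal} {f : EuclideanSpace ℝ (Fin n) → ℝ}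
  {x s v d : EuclideanSpace ℝ (Fin n)} {γ : ℝ}

theorem IsRegularSubgradient.mem_subdiff (hv : IsRegularSubgradient h x v) : v ∈ subdiff h x :=
  ⟨hv.1, hv.2.1, fun _ => x, fun _ => v, fun _ => hv, tendsto_const_nhds, tendsto_const_nhds,
    tendsto_const_nhds⟩

theorem IsRegularSubgradient.exists_eq_coe (hv : IsRegularSubgradient h x v) :
    ∃ r : ℝ, h x = r :=
  ⟨(h x).toReal, (EReal.coe_toReal hv.2.1 hv.1).symm⟩

theorem IsRegularSubgradient.inner_le_of_curve {c : ℝ → EuclideanSpace ℝ (Fin n)}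
    {w : EuclideanSpace ℝ (Fin n)} (hv : IsRegularSubgradient h (c 0) v) (hc : HasDerivAt c w 0)
    {θ : ℝ → ℝ} {M : ℝ} (hθ : HasDerivAt θ M 0) (h0 : h (c 0) = θ 0)
    (hle : ∀ᶠ t in 𝓝[>] (0 : ℝ), h (c t) ≤ θ t) : inner ℝ v w ≤ M := by
  have approx : ∀ ε > 0, inner ℝ v w - ε * ‖w‖ ≤ M := by
    intro ε hε
    have hcont : Tendsto c (𝓝[>] 0) (𝓝 (c 0)) := hc.continuousAt.mono_left nhdsWithin_le_nhds
    have hslope := hc.tendsto_slope_zero_right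
    refine le_of_tendsto_of_tendsto ((tendsto_const_nhds.inner hslope).sub
      (tendsto_const_nhds.mul hslope.norm)) hθ.tendsto_slope_zero_right ?_
    filter_upwards [hcont.eventually (hv.2.2 ε hε), hle, self_mem_nhdsWithin] with t hvt hct ht
    have hreal : inner ℝ v (c t - c 0) - ε * ‖c t - c 0‖ ≤ θ t - θ 0 := by
      rw [h0] at hvt
      rw [le_sub_iff_add_le']
      exact_mod_cast hvt.trans hct
    rw [zero_add, real_inner_smul_right, norm_smul, Real.norm_of_nonneg (inv_pos.2 ht).le,
      mul_left_comm, ← mul_sub, smul_eq_mul]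
    exact mul_le_mul_of_nonneg_left hreal (inv_pos.2 ht).le
  have hlim : Tendsto (fun ε : ℝ => inner ℝ v w - ε * ‖w‖) (𝓝[>] 0) (𝓝 (inner ℝ v w)) :=
    (Continuous.tendsto' (by fun_prop) _ _ (by simp)).mono_left nhdsWithin_le_nhds
  exact le_of_tendsto hlim (by filter_upwards [self_mem_nhdsWithin] with ε hε using approx ε hε)

theorem IsRegularSubgradient.sub_gradient_mem_convexSubdiff (hf : DifferentiableAt ℝ f x)
    (hg : IsPolyhedralFun g) (hφ : ∀ x, φ x = (f x : EReal) + g x)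
    (hv : IsRegularSubgradient φ x v) : v - gradient f x ∈ convexSubdiff g x := by
  obtain ⟨r, hr⟩ := hv.exists_eq_coe
  have hγ : g x = ((r - f x : ℝ) : EReal) := eq_coe_sub_of_coe_add_eq_coe ((hφ x).symm.trans hr)
  refine (mem_convexSubdiff_iff hγ).2 fun z τ hz => ?_
  have hray : HasDerivAt (fun t : ℝ => x + t • (z - x)) (z - x) 0 := by
    simpa using ((hasDerivAt_id (0 : ℝ)).smul_const (z - x)).const_add x
  have hθ := (hasDerivAt_comp_add_smul hf (z - x)).add
    (((hasDerivAt_id (0 : ℝ)).mul_const (τ - (r - f x))).const_add (r - f x))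
  have hfirst : inner ℝ v (z - x) ≤ inner ℝ (gradient f x) (z - x) + 1 * (τ - (r - f x)) := by
    refine IsRegularSubgradient.inner_le_of_curve (by simpa using hv) hray hθ (by simp [hr]) ?_
    filter_upwards [Ioo_mem_nhdsGT (zero_lt_one (α := ℝ))] with t ht
    rw [hφ]
    exact add_le_add_right (hg.add_smul_sub_le hγ.le hz ⟨ht.1.le, ht.2.le⟩) _
  rw [inner_sub_left]
  linarith

theorem isRegularSubgradient_gradient_add (hf : DifferentiableAt ℝ f x)
    (hφ : ∀ x, φ x = (f x : EReal) + g x) (hγ : g x = γ) (hs : s ∈ convexSubdiff g x) :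
    IsRegularSubgradient φ x (gradient f x + s) := by
  have hφx : φ x = ((f x + γ : ℝ) : EReal) := by rw [hφ, hγ, EReal.coe_add]
  refine ⟨hφx ▸ EReal.coe_ne_bot _, hφx ▸ EReal.coe_ne_top _, fun ε hε => ?_⟩
  filter_upwards [hf.hasGradientAt.hasFDerivAt.isLittleO.def hε] with z hz
  have htaylor : f x + inner ℝ (gradient f x) (z - x) - ε * ‖z - x‖ ≤ f z := by
    have := (abs_le.1 hz).1
    rw [InnerProductSpace.toDual_apply_apply] at this
    linarith
  calc φ x + ((inner ℝ (gradient f x + s) (z - x) - ε * ‖z - x‖ : ℝ) : EReal)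
      = ((f x + inner ℝ (gradient f x) (z - x) - ε * ‖z - x‖ : ℝ) : EReal)
          + (g x + ((inner ℝ s (z - x) : ℝ) : EReal)) := by
        rw [hφx, hγ, inner_add_left]
        norm_cast
        ring
    _ ≤ f z + g z := add_le_add (EReal.coe_le_coe_iff.2 htaylor) (hs z)
    _ = φ z := (hφ z).symm

theorem mem_subdiff_add_iff (hf : Differentiable ℝ f) (hf' : Continuous (gradient f))
    (hg : IsPolyhedralFun g) (hφ : ∀ x, φ x = (f x : EReal) + g x) (hγ : g x = γ) :
    v ∈ subdiff φ x ↔ v - gradient f x ∈ convexSubdiff g x := by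
  constructor
  · rintro ⟨-, -, xs, vs, hvs, hxs, hφs, hvlim⟩
    refine (mem_convexSubdiff_iff hγ).2 fun z τ hz => ?_
    choose rs hrs using fun k => (hvs k).exists_eq_coe
    have hγs k : g (xs k) = ((rs k - f (xs k) : ℝ) : EReal) :=
      eq_coe_sub_of_coe_add_eq_coe ((hφ _).symm.trans (hrs k))
    have hrs_lim : Tendsto rs atTop (𝓝 (f x + γ)) := by
      rw [← EReal.tendsto_coe, EReal.coe_add, ← hγ, ← hφ]
      exact hφs.congr hrs
    have hγs_lim : Tendsto (fun k => rs k - f (xs k)) atTop (𝓝 γ) := by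
      simpa using hrs_lim.sub ((hf.continuous.tendsto x).comp hxs)
    have hlim := hγs_lim.add ((hvlim.sub ((hf'.tendsto x).comp hxs)).inner
      ((tendsto_const_nhds (x := z)).sub hxs))
    exact le_of_tendsto hlim (.of_forall fun k => (mem_convexSubdiff_iff (hγs k)).1
      ((hvs k).sub_gradient_mem_convexSubdiff (hf _) hg hφ) z τ hz)
  · intro hs
    simpa using (isRegularSubgradient_gradient_add (hf x) hφ hγ hs).mem_subdiff

theorem exists_isRelIntSubgradient (hf : Differentiable ℝ f) (hf' : Continuous (gradient f))
    (hg : IsPolyhedralFun g) (hφ : ∀ x, φ x = (f x : EReal) + g x)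
    (hri : 0 ∈ intrinsicInterior ℝ (subdiff φ x)) :
    ∃ γ L ε, IsRelIntSubgradient g x γ (-gradient f x) L ε := by
  obtain ⟨hbot, htop, -⟩ := intrinsicInterior_subset hri
  obtain ⟨r, hr⟩ : ∃ r : ℝ, φ x = r := ⟨(φ x).toReal, (EReal.coe_toReal htop hbot).symm⟩
  have hγ : g x = ((r - f x : ℝ) : EReal) := eq_coe_sub_of_coe_add_eq_coe ((hφ x).symm.trans hr)
  have hiff s : s ∈ subdiff φ x ↔ -gradient f x + s ∈ convexSubdiff g x := by
    rw [mem_subdiff_add_iff hf hf' hg hφ hγ, sub_eq_neg_add]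
  obtain ⟨ε, hε, hball⟩ := exists_closedBall_subset_of_zero_mem_intrinsicInterior hri
  exact ⟨r - f x, Submodule.span ℝ (subdiff φ x), ε, hγ, hε,
    fun s hs hsε => (hiff s).1 (hball s hs hsε),
    fun s hs => Submodule.subset_span ((hiff s).2 hs)⟩

end RegularSubgradient

section KL

theorem isDesingularizing_rpow {a c β : ℝ} (hc : 0 < c) (hβ0 : 0 ≤ β) (hβ1 : β < 1) :
    IsDesingularizing (a : EReal) (fun s => c * s ^ (1 - β)) := by
  have hderiv : ∀ s : ℝ, 0 < s →
      HasDerivAt (fun s : ℝ => c * s ^ (1 - β)) (c * ((1 - β) * s ^ (-β))) s := fun s hs => by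
    simpa using (Real.hasDerivAt_rpow_const (p := 1 - β) (Or.inl hs.ne')).const_mul c
  have hset : {s : ℝ | 0 ≤ s ∧ (s : EReal) < a} = Set.Ico 0 a := by
    ext s; simp
  refine ⟨by simp [Real.zero_rpow (sub_pos.2 hβ1).ne'],
    fun s hs _ => mul_nonneg hc.le (Real.rpow_nonneg hs _), ?_, ?_,
    fun s hs => (hderiv s hs.1).differentiableAt.differentiableWithinAt, ?_, ?_⟩
  · exact (continuous_const.mul (Real.continuous_rpow_const (sub_pos.2 hβ1).le)).continuousOn
  · rw [hset]
    exact ((Real.concaveOn_rpow (sub_pos.2 hβ1).le (by linarith)).subset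
      Set.Ico_subset_Ici_self (convex_Ico 0 a)).smul hc.le
  · refine ContinuousOn.congr (f := fun s => c * ((1 - β) * s ^ (-β))) (fun s hs => ?_)
      fun s hs => (hderiv s hs.1).deriv
    exact (continuousAt_const.mul (continuousAt_const.mul
      (Real.continuousAt_rpow_const _ _ (Or.inl hs.1.ne')))).continuousWithinAt
  · intro s hs _
    rw [(hderiv s hs).deriv]
    exact mul_pos hc (mul_pos (sub_pos.2 hβ1) (Real.rpow_pos_of_pos hs _))

theorem deriv_mul_rpow_one_sub {c β s : ℝ} (hs : 0 < s) :
    deriv (fun s : ℝ => c * s ^ (1 - β)) s = c * (1 - β) / s ^ β := by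
  rw [((Real.hasDerivAt_rpow_const (Or.inl hs.ne')).const_mul c).deriv,
    show 1 - β - 1 = -β by ring, Real.rpow_neg hs.le]
  ring

theorem one_le_ofReal_div_mul_infEDist_iff {F : Type*} [SeminormedAddCommGroup F] {S : Set F}
    {K p : ℝ} (hK : 0 < K) (hp : 0 < p) :
    1 ≤ ENNReal.ofReal (K / p) * Metric.infEDist 0 S ↔ ∀ v ∈ S, p ≤ K * ‖v‖ := by
  rw [← inv_div, ENNReal.ofReal_inv_of_pos (by positivity), mul_comm, ← div_eq_mul_inv,
    ENNReal.le_div_iff_mul_le (Or.inl (by simpa using div_pos hp hK))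
      (Or.inl ENNReal.ofReal_ne_top), one_mul, Metric.le_infEDist]
  refine forall₂_congr fun v _ => ?_
  rw [edist_comm, edist_zero_right, ← ofReal_norm, ENNReal.ofReal_le_ofReal_iff (norm_nonneg v),
    div_le_iff₀' hK]

variable {n : ℕ} {h : EuclideanSpace ℝ (Fin n) → EReal} {x₀ : EuclideanSpace ℝ (Fin n)} {β η : ℝ}

theorem HasKLExponent.exists_rpow_le (hη : h x₀ = η) (hkl : HasKLExponent h x₀ β) :
    ∃ K > 0, ∃ a > 0, ∀ᶠ x in 𝓝 x₀, ∀ s ∈ Set.Ioo 0 a, h x = ((η + s : ℝ) : EReal) →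
      ∀ v ∈ subdiff h x, s ^ β ≤ K * ‖v‖ := by
  obtain ⟨-, hβ1, c, hc, -, -, -, a, ha, -, V, hV, hineq⟩ := hkl
  obtain ⟨a', ha'0, ha'⟩ := EReal.lt_iff_exists_real_btwn.1 ha
  have hK : 0 < c * (1 - β) := mul_pos hc (sub_pos.2 hβ1)
  refine ⟨c * (1 - β), hK, a', by exact_mod_cast ha'0, ?_⟩
  filter_upwards [hV] with x hx s hs hxs
  have hsub : h x - h x₀ = s := by
    rw [hxs, hη, ← EReal.coe_sub, add_sub_cancel_left]
  have hdist := hineq x hx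
  rw [hsub, EReal.toReal_coe, deriv_mul_rpow_one_sub hs.1] at hdist
  exact (one_le_ofReal_div_mul_infEDist_iff hK (Real.rpow_pos_of_pos hs.1 β)).1
    (hdist (by exact_mod_cast hs.1) ((EReal.coe_lt_coe_iff.2 hs.2).trans ha'))

/-- The inequality at regular subgradients passes to limiting ones because it holds at all nearby
points and both sides are continuous. -/
theorem HasKLExponent.of_forall_isRegularSubgradient (hη : h x₀ = η) (hβ0 : 0 ≤ β) (hβ1 : β < 1)
    (hp : ProperFun h) (hl : LowerSemicontinuous h) (hne : (subdiff h x₀).Nonempty) {K a : ℝ}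
    (hK : 0 < K) (ha : 0 < a)
    (hreg : ∀ᶠ x in 𝓝 x₀, ∀ s ∈ Set.Ioo 0 a, h x = ((η + s : ℝ) : EReal) →
      ∀ v, IsRegularSubgradient h x v → s ^ β ≤ K * ‖v‖) : HasKLExponent h x₀ β := by
  have hβ : 0 < 1 - β := sub_pos.2 hβ1
  refine ⟨hβ0, hβ1, K / (1 - β), by positivity, hp, hl, hne, a, by exact_mod_cast ha,
    isDesingularizing_rpow (by positivity) hβ0 hβ1, _, eventually_eventually_nhds.2 hreg, ?_⟩
  intro x hx h0 h1
  obtain ⟨s, hs⟩ : ∃ s : ℝ, h x = ((η + s : ℝ) : EReal) := by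
    have htop : h x ≠ ⊤ := fun htop => by simp [htop, hη] at h1
    exact ⟨(h x).toReal - η, by rw [add_sub_cancel, EReal.coe_toReal htop (hp.1 x)]⟩
  have hsub : h x - h x₀ = s := by
    rw [hs, hη, ← EReal.coe_sub, add_sub_cancel_left]
  rw [hsub] at h0 h1 ⊢
  have hs0 : s ∈ Set.Ioo 0 a := ⟨by exact_mod_cast h0, by exact_mod_cast h1⟩
  rw [EReal.toReal_coe, deriv_mul_rpow_one_sub hs0.1, div_mul_cancel₀ _ hβ.ne',
    one_le_ofReal_div_mul_infEDist_iff hK (Real.rpow_pos_of_pos hs0.1 β)]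
  rintro v ⟨-, -, xs, vs, hvs, hxs, hhs, hvlim⟩
  choose rs hrs using fun k => (hvs k).exists_eq_coe
  have hlim : Tendsto (fun k => rs k - η) atTop (𝓝 s) := by
    rw [hs] at hhs
    simpa using ((EReal.tendsto_coe.1 (hhs.congr hrs)).sub_const η)
  refine le_of_tendsto_of_tendsto (hlim.rpow_const (Or.inl hs0.1.ne')) (hvlim.norm.const_mul K) ?_
  filter_upwards [hxs.eventually hx, hlim.eventually (isOpen_Ioo.mem_nhds hs0)] with k hk hks
  exact hk _ hks (by rw [add_sub_cancel, hrs]) _ (hvs k)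

end KL

section Coordinates

variable {ι : Type*} [Fintype ι]

theorem euclidean_norm_le_sqrt_card_mul {w : EuclideanSpace ℝ ι} {M : ℝ} (hM : 0 ≤ M)
    (h : ∀ i, |w i| ≤ M) : ‖w‖ ≤ √(Fintype.card ι) * M := by
  refine le_of_sq_le_sq ?_ (by positivity)
  rw [EuclideanSpace.norm_sq_eq, mul_pow, Real.sq_sqrt (Nat.cast_nonneg _)]
  calc ∑ i, ‖w i‖ ^ 2 ≤ ∑ _i : ι, M ^ 2 :=
        Finset.sum_le_sum fun i _ => pow_le_pow_left₀ (norm_nonneg _) (h i) 2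
    _ = Fintype.card ι * M ^ 2 := by simp

variable [DecidableEq ι]

theorem apply_eq_zero_of_mem_orthogonal {L : Submodule ℝ (EuclideanSpace ℝ ι)} {i : ι}
    (hi : EuclideanSpace.single i 1 ∈ L) {w : EuclideanSpace ℝ ι} (hw : w ∈ Lᗮ) : w i = 0 := by
  simpa [EuclideanSpace.inner_single_left] using L.inner_right_of_mem_orthogonal hi hw

/-- Subtracting the `i`-th basis vector from a subgradient leaves a subgradient, because the
`i`-th coordinate attains its minimum over the domain at `x₀`. -/
theorem IsRelIntSubgradient.single_mem {g : EuclideanSpace ℝ ι → EReal}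
    {x₀ q : EuclideanSpace ℝ ι} {γ ε : ℝ} {L : Submodule ℝ (EuclideanSpace ℝ ι)}
    (h : IsRelIntSubgradient g x₀ γ q L ε) {i : ι} (hx₀ : x₀ i = 0)
    (hdom : ∀ x, g x < ⊤ → 0 ≤ x i) : EuclideanSpace.single i 1 ∈ L := by
  have hsub : q + -EuclideanSpace.single i 1 ∈ convexSubdiff g x₀ := by
    refine (mem_convexSubdiff_iff h.value).2 fun z τ hz => ?_
    have hzi : 0 ≤ z i := hdom z (hz.trans_lt (EReal.coe_lt_top τ))
    have hq := h.add_inner_le z hz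
    rw [inner_add_left, inner_neg_left, EuclideanSpace.inner_single_left]
    simp only [map_one, one_mul, PiLp.sub_apply, hx₀]
    linarith
  exact neg_mem_iff.1 (h.mem_of_add_mem _ hsub)

end Coordinates

section SqMap

theorem IsRegularSubgradient.zero_comp {m n : ℕ}
    {G : EuclideanSpace ℝ (Fin m) → EuclideanSpace ℝ (Fin n)} (hG : LocallyLipschitz G)
    {h : EuclideanSpace ℝ (Fin n) → EReal} {y : EuclideanSpace ℝ (Fin m)}
    (h0 : IsRegularSubgradient h (G y) 0) : IsRegularSubgradient (h ∘ G) y 0 := by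
  refine ⟨h0.1, h0.2.1, fun ε hε => ?_⟩
  obtain ⟨K, t, ht, hK⟩ := hG y
  filter_upwards [hG.continuous.continuousAt.eventually (h0.2.2 (ε / (K + 1)) (by positivity)), ht]
    with z hz hzt
  refine (add_le_add_right (EReal.coe_le_coe_iff.2 ?_) _).trans hz
  rw [inner_zero_left, inner_zero_left, zero_sub, zero_sub, neg_le_neg_iff]
  calc ε / (K + 1) * ‖G z - G y‖ ≤ ε / (K + 1) * ((K + 1) * ‖z - y‖) := by
        gcongr
        rw [← dist_eq_norm, ← dist_eq_norm]
        have := hK.dist_le_mul z hzt y (mem_of_mem_nhds ht)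
        linarith [dist_nonneg (x := z) (y := y)]
    _ = ε * ‖z - y‖ := by field_simp

variable {n : ℕ} {y y₀ d v : EuclideanSpace ℝ (Fin n)}

theorem sqMap_apply (y : EuclideanSpace ℝ (Fin n)) (i : Fin n) : sqMap y i = y i ^ 2 := rfl

theorem contDiff_sqMap : ContDiff ℝ 1 (sqMap (n := n)) :=
  contDiff_euclidean.2 fun i => by simp only [sqMap_apply]; fun_prop

/-- The curve through `y` whose componentwise square is the ray `t ↦ y² + t d`, for small `t` and
`d` supported on the support of `y`. -/
noncomputable def sqrtRay (y d : EuclideanSpace ℝ (Fin n)) (t : ℝ) : EuclideanSpace ℝ (Fin n) :=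
  WithLp.toLp 2 fun i => y i * √(1 + t * (d i / y i ^ 2))

/-- The velocity of `sqrtRay y d` at `t = 0`; its coordinates off the support of `y` are `0` by
the convention for division by zero. -/
noncomputable def sqrtRayVelocity (y d : EuclideanSpace ℝ (Fin n)) : EuclideanSpace ℝ (Fin n) :=
  WithLp.toLp 2 fun i => d i / (2 * y i)

theorem sqrtRay_zero (y d : EuclideanSpace ℝ (Fin n)) : sqrtRay y d 0 = y := by
  ext i; simp [sqrtRay]

theorem hasDerivAt_sqrtRay (y d : EuclideanSpace ℝ (Fin n)) :
    HasDerivAt (sqrtRay y d) (sqrtRayVelocity y d) 0 := by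
  suffices coords : HasDerivAt (fun (t : ℝ) (i : Fin n) => y i * √(1 + t * (d i / y i ^ 2)))
      (fun i => d i / (2 * y i)) 0 by
    have htoLp := PiLp.hasFDerivAt_toLp (𝕜 := ℝ) 2 fun i => y i * √(1 + 0 * (d i / y i ^ 2))
    exact htoLp.comp_hasDerivAt (0 : ℝ) coords
  refine hasDerivAt_pi.2 fun i => ?_
  have haffine : HasDerivAt (fun t : ℝ => 1 + t * (d i / y i ^ 2)) (d i / y i ^ 2) 0 := by
    simpa using ((hasDerivAt_id (0 : ℝ)).mul_const (d i / y i ^ 2)).const_add 1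
  refine ((haffine.sqrt (by simp)).const_mul (y i)).congr_deriv ?_
  by_cases hy : y i = 0
  · simp [hy]
  · simp only [zero_mul, add_zero, Real.sqrt_one]
    field_simp

theorem eventually_sqMap_sqrtRay (hd : ∀ i, y i = 0 → d i = 0) :
    ∀ᶠ t in 𝓝 (0 : ℝ), sqMap (sqrtRay y d t) = sqMap y + t • d := by
  have hpos : ∀ᶠ t in 𝓝 (0 : ℝ), ∀ i, 0 < 1 + t * (d i / y i ^ 2) := by
    refine eventually_all.2 fun i => ?_
    have hlim : Tendsto (fun t : ℝ => 1 + t * (d i / y i ^ 2)) (𝓝 0) (𝓝 1) :=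
      Continuous.tendsto' (by fun_prop) _ _ (by simp)
    exact hlim.eventually_const_lt zero_lt_one
  filter_upwards [hpos] with t ht
  ext i
  simp only [sqMap_apply, sqrtRay, PiLp.add_apply, PiLp.smul_apply, smul_eq_mul]
  rw [mul_pow, Real.sq_sqrt (ht i).le]
  by_cases hy : y i = 0
  · simp [hy, hd i hy]
  · field_simp

theorem IsRegularSubgradient.inner_sqrtRayVelocity_le {f : EuclideanSpace ℝ (Fin n) → ℝ}
    {g φ : EuclideanSpace ℝ (Fin n) → EReal} (hf : DifferentiableAt ℝ f (sqMap y))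
    (hφ : ∀ x, φ x = (f x : EReal) + g x) (hv : IsRegularSubgradient (φ ∘ sqMap) y v)
    (hd : ∀ i, y i = 0 → d i = 0) {κ : ℝ}
    (hκ : ∀ᶠ t in 𝓝[>] (0 : ℝ), g (sqMap y + t • d) ≤ g (sqMap y) + ((t * κ : ℝ) : EReal)) :
    inner ℝ v (sqrtRayVelocity y d) ≤ inner ℝ (gradient f (sqMap y)) d + κ := by
  obtain ⟨r, hr⟩ := hv.exists_eq_coe
  have hγ := eq_coe_sub_of_coe_add_eq_coe ((hφ (sqMap y)).symm.trans hr)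
  set γ := r - f (sqMap y)
  have hθ := (hasDerivAt_comp_add_smul hf d).add
    (((hasDerivAt_id (0 : ℝ)).mul_const κ).const_add γ)
  rw [one_mul] at hθ
  rw [← sqrtRay_zero y d] at hv
  refine hv.inner_le_of_curve (hasDerivAt_sqrtRay y d) hθ ?_ ?_
  · simp [sqrtRay_zero, hφ, hγ]
  · filter_upwards [hκ, nhdsWithin_le_nhds (eventually_sqMap_sqrtRay hd)] with t hgt hsq
    rw [Function.comp_apply, hsq, hφ]
    rw [hγ] at hgt
    exact add_le_add_right hgt _

theorem exists_forall_le_abs_apply (y₀ : EuclideanSpace ℝ (Fin n)) :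
    ∃ c > 0, ∀ᶠ y in 𝓝 y₀, ∀ i, y₀ i ≠ 0 → c ≤ |y i| := by
  have hlower : ∀ᶠ c in 𝓝[>] (0 : ℝ), ∀ i, y₀ i ≠ 0 → c < |y₀ i| :=
    eventually_all.2 fun i => eventually_imp_distrib_left.2 fun hi =>
      nhdsWithin_le_nhds (eventually_lt_nhds (abs_pos.2 hi))
  obtain ⟨c, hc, hc0⟩ := (hlower.and self_mem_nhdsWithin).exists
  refine ⟨c, hc0, eventually_all.2 fun i => eventually_imp_distrib_left.2 fun hi => ?_⟩
  have hcont : ContinuousAt (fun y : EuclideanSpace ℝ (Fin n) => |y i|) y₀ := by fun_prop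
  filter_upwards [hcont.eventually_const_lt (hc i hi)] with y hy using hy.le

theorem apply_eq_zero_of_forall_le_abs {c : ℝ} (hc : 0 < c) (hy : ∀ i, y₀ i ≠ 0 → c ≤ |y i|)
    {i : Fin n} (hi : y i = 0) : y₀ i = 0 := by
  by_contra hne
  exact hc.not_ge (by simpa [hi] using hy i hne)

theorem starProjection_sqMap_sub_apply {L : Submodule ℝ (EuclideanSpace ℝ (Fin n))} {i : Fin n}
    (hL : EuclideanSpace.single i 1 ∈ L) (hi : y₀ i = 0) (y : EuclideanSpace ℝ (Fin n)) :
    L.starProjection (sqMap y - sqMap y₀) i = y i ^ 2 := by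
  have hw := apply_eq_zero_of_mem_orthogonal hL
    (L.sub_starProjection_mem_orthogonal (sqMap y - sqMap y₀))
  rw [PiLp.sub_apply, sub_eq_zero] at hw
  rw [← hw, PiLp.sub_apply, sqMap_apply, sqMap_apply, hi, zero_pow two_ne_zero, sub_zero]

theorem abs_sqrtRayVelocity_apply_le {c : ℝ} (hc : 0 < c) {i : Fin n} (hi : c ≤ |y i|) :
    |sqrtRayVelocity y d i| ≤ c⁻¹ * ‖d‖ := by
  calc |d i / (2 * y i)| = |d i| / (2 * |y i|) := by rw [abs_div, abs_mul, abs_two]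
    _ ≤ ‖d‖ / (1 * c) := by
        gcongr
        · exact PiLp.norm_apply_le d i
        · exact one_le_two
    _ = c⁻¹ * ‖d‖ := by rw [one_mul, div_eq_inv_mul]

theorem norm_sqrtRayVelocity_le {c : ℝ} (hc : 0 < c) (hy : ∀ i, y₀ i ≠ 0 → c ≤ |y i|)
    (hd : ∀ i, y₀ i = 0 → d i = 0) : ‖sqrtRayVelocity y d‖ ≤ √n * c⁻¹ * ‖d‖ := by
  refine (euclidean_norm_le_sqrt_card_mul (M := c⁻¹ * ‖d‖) (by positivity) fun i => ?_).trans_eq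
    (by rw [Fintype.card_fin, mul_assoc])
  by_cases hi : y₀ i = 0
  · simp only [sqrtRayVelocity, hd i hi, zero_div, abs_zero]
    positivity
  · exact abs_sqrtRayVelocity_apply_le hc (hy i hi)

/-- Where `|d i| = y i ^ 2`, the velocity `d i / (2 * y i)` has size `√|d i| / 2`. -/
theorem norm_sqrtRayVelocity_le_sqrt {c : ℝ} (hc : 0 < c) (hy : ∀ i, y₀ i ≠ 0 → c ≤ |y i|)
    (hd : ∀ i, y₀ i = 0 → |d i| = y i ^ 2) (hd1 : ‖d‖ ≤ 1) :
    ‖sqrtRayVelocity y d‖ ≤ √n * (1 + c⁻¹) * √‖d‖ := by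
  refine (euclidean_norm_le_sqrt_card_mul (M := (1 + c⁻¹) * √‖d‖) (by positivity)
    fun i => ?_).trans_eq (by rw [Fintype.card_fin, mul_assoc])
  by_cases hi : y₀ i = 0
  · calc |d i / (2 * y i)| = |y i| / 2 := by
          rw [abs_div, abs_mul, abs_two, hd i hi, ← sq_abs]
          field_simp
      _ ≤ |y i| := half_le_self (abs_nonneg _)
      _ = √|d i| := by rw [hd i hi, Real.sqrt_sq_eq_abs]
      _ ≤ √‖d‖ := Real.sqrt_le_sqrt (PiLp.norm_apply_le d i)
      _ ≤ (1 + c⁻¹) * √‖d‖ := le_mul_of_one_le_left (by positivity) (by simp [hc.le])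
  · have hd' : ‖d‖ ≤ √‖d‖ := Real.le_sqrt_of_sq_le (by nlinarith [norm_nonneg d])
    calc |sqrtRayVelocity y d i| ≤ c⁻¹ * ‖d‖ := abs_sqrtRayVelocity_apply_le hc (hy i hi)
      _ ≤ (1 + c⁻¹) * √‖d‖ := by gcongr; linarith

end SqMap

section Bounds

variable {n : ℕ} {f : EuclideanSpace ℝ (Fin n) → ℝ} {g φ : EuclideanSpace ℝ (Fin n) → EReal}
  {x₀ y₀ : EuclideanSpace ℝ (Fin n)} {γ ε α : ℝ} {L : Submodule ℝ (EuclideanSpace ℝ (Fin n))}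

theorem IsRelIntSubgradient.exists_sqrt_norm_starProjection_le (hf : Differentiable ℝ f)
    (hf' : Continuous (gradient f)) (hφ : ∀ x, φ x = (f x : EReal) + g x)
    (h : IsRelIntSubgradient g (sqMap y₀) γ (-gradient f (sqMap y₀)) L ε)
    (hg : IsPolyhedralFun g) (hL : ∀ i, y₀ i = 0 → EuclideanSpace.single i 1 ∈ L) :
    ∃ b ≥ (0 : ℝ), ∀ᶠ y in 𝓝 y₀, ∀ v, IsRegularSubgradient (φ ∘ sqMap) y v →
      √‖L.starProjection (sqMap y - sqMap y₀)‖ ≤ b * ‖v‖ := by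
  have hε := h.pos
  obtain ⟨c, hc, hcy⟩ := exists_forall_le_abs_apply y₀
  set A := √n * (1 + c⁻¹)
  have hgrad : ∀ᶠ x in 𝓝 (sqMap y₀), ‖gradient f x - gradient f (sqMap y₀)‖ < ε / 2 := by
    have hlim : Tendsto (fun x => ‖gradient f x - gradient f (sqMap y₀)‖) (𝓝 (sqMap y₀)) (𝓝 0) :=
      Continuous.tendsto' (by fun_prop) _ _ (by simp)
    exact hlim.eventually_lt_const (half_pos hε)
  have hsmall := (tendsto_starProjection_sub (sqMap y₀) L).norm.eventually_lt_const
    (norm_zero.trans_lt one_pos)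
  refine ⟨A / (ε / 2), by positivity, ?_⟩
  filter_upwards [hcy, contDiff_sqMap.continuous.continuousAt.eventually
    (hgrad.and (hsmall.and (h.eventually_segment_le hg)))] with y hy ⟨hgy, hu1, hseg⟩ v hv
  have hu : ∀ i, y₀ i = 0 → L.starProjection (sqMap y - sqMap y₀) i = y i ^ 2 := fun i hi =>
    starProjection_sqMap_sub_apply (hL i hi) hi y
  set u := L.starProjection (sqMap y - sqMap y₀)
  have hsupp : ∀ i, y i = 0 → (-u) i = 0 := fun i hi => by
    simp [hu i (apply_eq_zero_of_forall_le_abs hc hy hi), hi]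
  have hfirst := hv.inner_sqrtRayVelocity_le (hf _) hφ hsupp (by
    filter_upwards [Ioo_mem_nhdsGT (zero_lt_one (α := ℝ))] with t ht
      using hseg t ⟨ht.1.le, ht.2.le⟩)
  have hvel : ‖sqrtRayVelocity y (-u)‖ ≤ A * √‖u‖ := by
    simpa using norm_sqrtRayVelocity_le_sqrt hc hy (d := -u)
      (fun i hi => by simp [hu i hi]) (by simpa using hu1.le)
  have hcs : -inner ℝ (gradient f (sqMap y) - gradient f (sqMap y₀)) u ≤ ε / 2 * ‖u‖ :=
    (neg_le_abs _).trans ((abs_real_inner_le_norm _ _).trans (by gcongr))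
  rw [div_mul_eq_mul_div, le_div_iff₀ (half_pos hε), mul_comm]
  refine mul_le_mul_norm_of_inner_le_neg (by positivity) (Real.sqrt_nonneg _) hvel ?_
  rw [Real.sq_sqrt (norm_nonneg u)]
  rw [inner_sub_left] at hcs
  rw [inner_neg_right, inner_neg_neg] at hfirst
  linarith

theorem IsRelIntSubgradient.exists_norm_starProjection_gradient_le (hf : Differentiable ℝ f)
    (hφ : ∀ x, φ x = (f x : EReal) + g x)
    (h : IsRelIntSubgradient g (sqMap y₀) γ (-gradient f (sqMap y₀)) L ε)
    (hg : IsPolyhedralFun g) (hL : ∀ i, y₀ i = 0 → EuclideanSpace.single i 1 ∈ L) :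
    ∃ A ≥ (0 : ℝ), ∀ᶠ y in 𝓝 y₀, ∀ v, IsRegularSubgradient (φ ∘ sqMap) y v →
      ‖Lᗮ.starProjection (gradient f (sqMap y) - gradient f (sqMap y₀))‖ ≤ A * ‖v‖ := by
  obtain ⟨c, hc, hcy⟩ := exists_forall_le_abs_apply y₀
  refine ⟨√n * c⁻¹, by positivity, ?_⟩
  filter_upwards [hcy, contDiff_sqMap.continuous.continuousAt.eventually
    (h.eventually_add_le hg)] with y hy htrans v hv
  have hnorm := real_inner_starProjection_self Lᗮ (gradient f (sqMap y) - gradient f (sqMap y₀))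
  set r := Lᗮ.starProjection (gradient f (sqMap y) - gradient f (sqMap y₀))
  have hrL : r ∈ Lᗮ := Lᗮ.starProjection_apply_mem _
  have hr : ∀ i, y₀ i = 0 → (-r) i = 0 := fun i hi =>
    apply_eq_zero_of_mem_orthogonal (hL i hi) (neg_mem hrL)
  have hsupp : ∀ i, y i = 0 → (-r) i = 0 := fun i hi =>
    hr i (apply_eq_zero_of_forall_le_abs hc hy hi)
  have hray : Tendsto (fun t : ℝ => t • -r) (𝓝[>] 0) (𝓝 0) :=
    (Continuous.tendsto' (by fun_prop) _ _ (by simp)).mono_left nhdsWithin_le_nhds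
  have hfirst := hv.inner_sqrtRayVelocity_le (hf _) hφ hsupp
    (κ := inner ℝ (-gradient f (sqMap y₀)) (-r)) (by
      filter_upwards [hray.eventually htrans] with t ht
      rw [← real_inner_smul_right]
      exact ht (Lᗮ.smul_mem _ (neg_mem hrL)))
  have hvel : ‖sqrtRayVelocity y (-r)‖ ≤ √n * c⁻¹ * ‖r‖ := by
    simpa using norm_sqrtRayVelocity_le hc hy hr
  rw [← one_mul ‖r‖]
  refine mul_le_mul_norm_of_inner_le_neg (by positivity) (norm_nonneg r) hvel ?_
  rw [real_inner_comm, inner_sub_left] at hnorm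
  rw [inner_neg_right, inner_neg_neg] at hfirst
  linarith

theorem IsRelIntSubgradient.eventually_isRegularSubgradient (hf : Differentiable ℝ f)
    (hf' : Continuous (gradient f)) (hφ : ∀ x, φ x = (f x : EReal) + g x)
    (h : IsRelIntSubgradient g x₀ γ (-gradient f x₀) L ε) (hg : IsPolyhedralFun g) :
    ∀ᶠ d in 𝓝 0, d ∈ Lᗮ → IsRegularSubgradient φ (x₀ + d)
      (Lᗮ.starProjection (gradient f (x₀ + d) - gradient f x₀)) := by
  have hlim : Tendsto (fun d => ‖L.starProjection (gradient f (x₀ + d) - gradient f x₀)‖)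
      (𝓝 0) (𝓝 0) :=
    Continuous.tendsto' (by fun_prop) _ _ (by simp)
  filter_upwards [h.eventually_eq_add_inner hg, hlim.eventually_lt_const h.pos] with d hgd hsmall hd
  have hs := h.add_mem_convexSubdiff hd (hgd hd)
    (L.neg_mem (L.starProjection_apply_mem (gradient f (x₀ + d) - gradient f x₀)))
    (by rw [norm_neg]; exact hsmall.le)
  convert isRegularSubgradient_gradient_add (hf _) hφ (hgd hd) hs using 1
  rw [L.starProjection_orthogonal_val]
  abel

/-- The excess of `φ` along `x₀ + Lᗮ` is the Taylor remainder of `f`, since `g` is affine there. -/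
theorem IsRelIntSubgradient.exists_rpow_taylor_le (hf : Differentiable ℝ f)
    (hf' : Continuous (gradient f)) (hφ : ∀ x, φ x = (f x : EReal) + g x)
    (h : IsRelIntSubgradient g x₀ γ (-gradient f x₀) L ε) (hg : IsPolyhedralFun g)
    (hKL : HasKLExponent φ x₀ α) :
    ∃ K > 0, ∀ᶠ d in 𝓝 0, d ∈ Lᗮ → 0 < f (x₀ + d) - f x₀ + inner ℝ (-gradient f x₀) d →
      (f (x₀ + d) - f x₀ + inner ℝ (-gradient f x₀) d) ^ α ≤
        K * ‖Lᗮ.starProjection (gradient f (x₀ + d) - gradient f x₀)‖ := by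
  have hη : φ x₀ = ((f x₀ + γ : ℝ) : EReal) := by rw [hφ, h.value, EReal.coe_add]
  obtain ⟨K, hK, a, ha, hineq⟩ := hKL.exists_rpow_le hη
  have hbase : Tendsto (fun d => x₀ + d) (𝓝 0) (𝓝 x₀) :=
    Continuous.tendsto' (by fun_prop) _ _ (by simp)
  have hexcess : Tendsto (fun d => f (x₀ + d) - f x₀ + inner ℝ (-gradient f x₀) d) (𝓝 0) (𝓝 0) := by
    have hfc := hf.continuous
    exact Continuous.tendsto' (by fun_prop) _ _ (by simp)
  refine ⟨K, hK, ?_⟩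
  filter_upwards [h.eventually_isRegularSubgradient hf hf' hφ hg, h.eventually_eq_add_inner hg,
    hbase.eventually hineq, hexcess.eventually_lt_const ha] with d hreg hgd hd hda hdL hpos
  refine hd _ ⟨hpos, hda⟩ ?_ _ (hreg hdL).mem_subdiff
  rw [hφ, hgd hdL, ← EReal.coe_add]
  congr 1
  ring

theorem rpow_max_half_le {s s' p v b C D : ℝ} (hα0 : 0 ≤ α) (hα1 : α ≤ 1)
    (hs : s ∈ Set.Ioc (0 : ℝ) 1) (hC : 0 ≤ C) (hDv : 0 ≤ D * v) (hp : √p ≤ b * v)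
    (hss' : s ≤ s' + C * p) (hs' : 0 < s' → s' ^ α ≤ D * v) :
    s ^ max α (1 / 2) ≤ (√(2 * C) * b + 2 * D) * v := by
  obtain ⟨hs0, hs1⟩ := hs
  have hbv : √(2 * C) * √p ≤ √(2 * C) * (b * v) := by gcongr
  rcases le_or_gt s' (s / 2) with hle | hlt
  · calc s ^ max α (1 / 2) ≤ s ^ (1 / 2 : ℝ) :=
          Real.rpow_le_rpow_of_exponent_ge hs0 hs1 (le_max_right _ _)
      _ = √s := (Real.sqrt_eq_rpow s).symm
      _ ≤ √(2 * C * p) := Real.sqrt_le_sqrt (by linarith)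
      _ = √(2 * C) * √p := Real.sqrt_mul (by positivity) p
      _ ≤ (√(2 * C) * b + 2 * D) * v := by linarith
  · have hs'0 : 0 < s' := (half_pos hs0).trans hlt
    calc s ^ max α (1 / 2) ≤ s ^ α :=
          Real.rpow_le_rpow_of_exponent_ge hs0 hs1 (le_max_left _ _)
      _ ≤ (2 * s') ^ α := Real.rpow_le_rpow hs0.le (by linarith) hα0
      _ = 2 ^ α * s' ^ α := Real.mul_rpow zero_le_two hs'0.le
      _ ≤ 2 * (D * v) := by
          gcongr
          · exact (Real.rpow_le_rpow_of_exponent_le one_le_two hα1).trans_eq (Real.rpow_one 2)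
          · exact hs' hs'0
      _ ≤ (√(2 * C) * b + 2 * D) * v := by
          linarith [mul_nonneg (Real.sqrt_nonneg (2 * C)) (Real.sqrt_nonneg p)]

/-- The Taylor remainder on `x₀ + Lᗮ` is controlled at the projection of `x = y²`; Lipschitz
continuity moves the bound from that projection back to `x`. -/
theorem IsRelIntSubgradient.exists_rpow_le_norm (hf : Differentiable ℝ f)
    (hf' : LocallyLipschitz (gradient f)) (hφ : ∀ x, φ x = (f x : EReal) + g x)
    (h : IsRelIntSubgradient g (sqMap y₀) γ (-gradient f (sqMap y₀)) L ε)
    (hg : IsPolyhedralFun g) (hL : ∀ i, y₀ i = 0 → EuclideanSpace.single i 1 ∈ L)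
    (hKL : HasKLExponent φ (sqMap y₀) α) :
    ∃ K > 0, ∀ᶠ y in 𝓝 y₀, ∀ s ∈ Set.Ioo (0 : ℝ) 1,
      (φ ∘ sqMap) y = ((f (sqMap y₀) + γ + s : ℝ) : EReal) →
      ∀ v, IsRegularSubgradient (φ ∘ sqMap) y v → s ^ max α (1 / 2) ≤ K * ‖v‖ := by
  obtain ⟨b, hb0, hb⟩ := h.exists_sqrt_norm_starProjection_le hf hf'.continuous hφ hg hL
  obtain ⟨A, hA0, hA⟩ := h.exists_norm_starProjection_gradient_le hf hφ hg hL
  obtain ⟨C, hC0, hC⟩ :=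
    h.exists_excess_le (locallyLipschitz_of_continuous_gradient hf hf'.continuous) hφ hg
  obtain ⟨M, hM0, hM⟩ := exists_norm_sub_le_norm_starProjection hf' (sqMap y₀) L
  obtain ⟨K, hK0, hK⟩ := h.exists_rpow_taylor_le hf hf'.continuous hφ hg hKL
  set D := K * (A + M * b)
  have hsmall := (tendsto_starProjection_sub (sqMap y₀) L).norm.eventually_lt_const
    (norm_zero.trans_lt one_pos)
  have hproj := (tendsto_starProjection_sub (sqMap y₀) Lᗮ).eventually hK
  refine ⟨√(2 * C) * b + 2 * D + 1, by positivity, ?_⟩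
  filter_upwards [hb, hA, contDiff_sqMap.continuous.continuousAt.eventually
    (hC.and (hM.and (hproj.and hsmall)))] with y hby hAy ⟨hCy, hMy, hKy, hu1⟩ s hs hys v hv
  set u := L.starProjection (sqMap y - sqMap y₀)
  set w := Lᗮ.starProjection (sqMap y - sqMap y₀)
  have hu : ‖u‖ ≤ b * ‖v‖ :=
    (Real.le_sqrt_of_sq_le (pow_le_of_le_one (norm_nonneg u) hu1.le two_ne_zero)).trans (hby v hv)
  have hgrad : ‖Lᗮ.starProjection (gradient f (sqMap y₀ + w) - gradient f (sqMap y₀))‖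
      ≤ (A + M * b) * ‖v‖ := by
    calc _ ≤ A * ‖v‖ + M * ‖u‖ := (norm_starProjection_sub_le Lᗮ _ (gradient f (sqMap y)) _).trans
          (add_le_add (hAy v hv) hMy)
      _ ≤ A * ‖v‖ + M * (b * ‖v‖) := by gcongr
      _ = (A + M * b) * ‖v‖ := by ring
  have hexcess (hpos : 0 < f (sqMap y₀ + w) - f (sqMap y₀) + inner ℝ (-gradient f (sqMap y₀)) w) :
      (f (sqMap y₀ + w) - f (sqMap y₀) + inner ℝ (-gradient f (sqMap y₀)) w) ^ α ≤ D * ‖v‖ :=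
    (hKy (Lᗮ.starProjection_apply_mem _) hpos).trans (by rw [mul_assoc]; gcongr)
  have hcore := rpow_max_half_le hKL.1 hKL.2.1.le ⟨hs.1, hs.2.le⟩ hC0 (by positivity) (hby v hv)
    (hCy s hys) hexcess
  linarith [norm_nonneg v]

end Bounds

theorem theorem5p12_general {n : ℕ} {f : EuclideanSpace ℝ (Fin n) → ℝ} (hf : Differentiable ℝ f)
    (hf' : LocallyLipschitz (gradient f)) {g : EuclideanSpace ℝ (Fin n) → EReal}
    (hg : IsPolyhedralFun g) {φ : EuclideanSpace ℝ (Fin n) → EReal}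
    (hφ : ∀ x, φ x = (f x : EReal) + g x) {y₀ : EuclideanSpace ℝ (Fin n)}
    (hdom : ∀ x, g x < ⊤ → ∀ i, y₀ i = 0 → 0 ≤ x i)
    (hri : 0 ∈ intrinsicInterior ℝ (subdiff φ (sqMap y₀))) {α : ℝ}
    (hKL : HasKLExponent φ (sqMap y₀) α) : HasKLExponent (φ ∘ sqMap) y₀ (max α (1 / 2)) := by
  obtain ⟨γ, L, ε, h⟩ := exists_isRelIntSubgradient hf hf'.continuous hg hφ hri
  have hL : ∀ i, y₀ i = 0 → EuclideanSpace.single i 1 ∈ L := fun i hi =>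
    h.single_mem (by simp [sqMap_apply, hi]) fun x hx => hdom x hx i hi
  have hη : φ (sqMap y₀) = ((f (sqMap y₀) + γ : ℝ) : EReal) := by rw [hφ, h.value, EReal.coe_add]
  have hzero : IsRegularSubgradient φ (sqMap y₀) 0 := by
    simpa using isRegularSubgradient_gradient_add (hf _) hφ h.value h.mem_convexSubdiff
  obtain ⟨K, hK, hineq⟩ := h.exists_rpow_le_norm hf hf' hφ hg hL hKL
  obtain ⟨-, hα1, -, -, hproper, hlsc, -⟩ := hKL
  exact .of_forall_isRegularSubgradient hη (le_max_of_le_right (by norm_num))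
    (max_lt hα1 (by norm_num)) ⟨fun y => hproper.1 _, y₀, hη.trans_ne (EReal.coe_ne_top _)⟩
    (hlsc.comp contDiff_sqMap.continuous)
    ⟨0, (hzero.zero_comp contDiff_sqMap.locallyLipschitz).mem_subdiff⟩ hK one_pos hineq

theorem theorem5p12 (n : ℕ) (f : EuclideanSpace ℝ (Fin n) → ℝ) (hf : ContDiff ℝ 2 f)
    (g : EuclideanSpace ℝ (Fin n) → EReal) (hg : ProperFun g) (hgpoly : IsPolyhedralFun g)
    (hgdom : ∀ x, g x < ⊤ → ∀ i, 0 ≤ x i)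
    (φ Φ : EuclideanSpace ℝ (Fin n) → EReal)
    (hφ : ∀ x, φ x = (f x : EReal) + g x)
    (hΦ : ∀ y, Φ y = (f (sqMap y) : EReal) + g (sqMap y))
    (x₀ y₀ : EuclideanSpace ℝ (Fin n)) (hxy : x₀ = sqMap y₀)
    (hri : (0 : EuclideanSpace ℝ (Fin n)) ∈ intrinsicInterior ℝ (subdiff φ x₀))
    (α : ℝ) (hα0 : 0 < α) (hα1 : α < 1) (hKL : HasKLExponent φ x₀ α) :
    HasKLExponent Φ y₀ (max α (1 / 2)) := by
  subst hxy
  obtain rfl : Φ = φ ∘ sqMap := funext fun y => (hΦ y).trans (hφ _).symm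
  exact theorem5p12_general (hf.differentiable two_ne_zero) (locallyLipschitz_gradient hf) hgpoly hφ
    (fun x hx i _ => hgdom x hx i) hri hKL
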